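/- Let $\mathsf X,\mathsf Z$ be metric spaces, $\mathsf S=\mathsf X\times\mathsf Z$, and let $\mathsf A$ be a separable metric space. For a metric space $\mathsf Y$ let $bm\mathsf Y$ and $bc\mathsf Y$ be the bounded Borel measurable and the bounded continuous functions $\mathsf Y\to\mathbb R$, with the supremum norm. Let $Q$ be a Markov transition kernel on $\mathsf Z$. Let $\Gamma$ be a correspondence from $\mathsf S$ to $\mathsf A$ with graph $\{((x,z),a): a\in\Gamma(x,z)\}$, and let $H$ assign a real number $H(x,z,a,v)$ to every $((x,z),a)$ in the graph of $\Gamma$ and every $v\in bm\mathsf S$ (the candidate value functions). Assume: (i) (Regularity) $\Gamma$ is continuous (upper and lower hemicontinuous) with nonempty compact values; the map $(x,z,a)\mapsto H(x,z,a,v)$ on the graph of $\Gamma$ is Borel measurable for every $v\in bm\mathsf S$, continuous for every $v\in bc\mathsf S$, and bounded for at least one $v\in bc\mathsf S$. (ii) (Monotonicity) If $v,w\in bm\mathsf S$ and $v\le w$, then $H(x,z,a,v)\le H(x,z,a,w)$ for all $(x,z)\in\mathsf S$ and $a\in\Gamma(x,z)$. (iii) (Long-run contractivity) There is a nonnegative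 $\beta\in bm\mathsf Z$ such that for all $v,w\in bm\mathsf S$, $(x,z)\in\mathsf S$ and $a\in\Gamma(x,z)$, $$|H(x,z,a,v)-H(x,z,a,w)|\le\beta(z)\int\sup_{x'\in\mathsf X}|v(x',z')-w(x',z')|\,Q(z,dz')$$ (an upper integral if the supremum is not measurable in $z'$), and the operator $(L_\beta h)(z)=\beta(z)\int h(z')\,Q(z,dz')$ on $bm\mathsf Z$ has spectral radius $r(L_\beta)=\lim_{n\to\infty}\|L_\beta^n\|^{1/n}<1$. A feasible policy is a Borel measurable map $\sigma:\mathsf S\to\mathsf A$ with $\sigma(x,z)\in\Gamma(x,z)$ for all $(x,z)\in\mathsf S$. Put $(T_\sigma v)(x,z)=H(x,z,\sigma(x,z),v)$ and $(Tv)(x,z)=\sup_{a\in\Gamma(x,z)}H(x,z,a,v)$. Let $v_\sigma=\lim_{n\to\infty}T_\sigma^nv_0$ (a pointwise limit that has to exist and not to depend on $v_0\in bm\mathsf S$), and let $v^*(x,z)=\sup_\sigma v_\sigma(x,z)$, the supremum being over all feasible policies. Let $(\sigma_k)_{k\ge0}$ be a sequence of feasible policies generated by Howard's policy iteration, that is,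 $T_{\sigma_k}v_{\sigma_{k-1}}=Tv_{\sigma_{k-1}}$ for all $k\ge1$. Then $v_\sigma$ is well defined and belongs to $bm\mathsf S$ for every feasible policy $\sigma$, $v^*$ is well defined (a finite supremum), and $v_{\sigma_k}\to v^*$ uniformly on $\mathsf S$ as $k\to\infty$. -/

import Mathlib

open MeasureTheory ProbabilityTheory Filter Topology
open scoped ENNReal

noncomputable section

/-! ### Spaces of bounded functions -/

/-- The bounded measurable functions `Z → ℝ`, as a subspace of the Banach space of all bounded
functions with the supremum norm. -/
def boundedMeasurableSubmodule (Z : Type*) [MeasurableSpace Z] :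
    Submodule ℝ (lp (fun _ : Z => ℝ) ∞) where
  carrier := {f | Measurable (fun z => f z)}
  add_mem' := fun {f g} (hf : Measurable fun z => f z) (hg : Measurable fun z => g z) =>
    hf.add hg
  zero_mem' := (measurable_const : Measurable fun _ : Z => (0 : ℝ))
  smul_mem' := fun c f (hf : Measurable fun z => f z) => hf.const_mul c

/-- The space of bounded measurable functions `Z → ℝ` with the supremum norm. -/
def BoundedMeasurable (Z : Type*) [MeasurableSpace Z] : Type _ := boundedMeasurableSubmodule Z

instance (Z : Type*) [MeasurableSpace Z] : NormedAddCommGroup (BoundedMeasurable Z) :=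
  Submodule.normedAddCommGroup (boundedMeasurableSubmodule Z)

instance (Z : Type*) [MeasurableSpace Z] : NormedSpace ℝ (BoundedMeasurable Z) :=
  Submodule.normedSpace (boundedMeasurableSubmodule Z)

/-- The set of bounded Borel measurable functions `S → ℝ`. The Borel σ-algebra of the topology
of `S` is used explicitly: on a product of non-separable metric spaces it may be larger than the
product of the Borel σ-algebras. -/
def boundedBorel (S : Type*) [TopologicalSpace S] : Set (S → ℝ) :=
  {v | Measurable[borel S] v ∧ ∃ C : ℝ, ∀ s, |v s| ≤ C}

/-- The set of bounded continuous functions `S → ℝ`. -/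
def boundedCont (S : Type*) [TopologicalSpace S] : Set (S → ℝ) :=
  {v | Continuous v ∧ ∃ C : ℝ, ∀ s, |v s| ≤ C}

/-! ### The discount operator and its spectral radius -/

namespace BoundedMeasurable

variable {Z : Type*} [MeasurableSpace Z]

/-- The value of a bounded measurable function at a point. -/
def eval (h : BoundedMeasurable Z) (z : Z) : ℝ := h.1 z

theorem measurable_eval (h : BoundedMeasurable Z) : Measurable h.eval := h.2

theorem abs_eval_le (h : BoundedMeasurable Z) (z : Z) : |h.eval z| ≤ ‖h‖ :=
  lp.norm_apply_le_norm (E := fun _ : Z => ℝ) ENNReal.top_ne_zero h.1 z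

/-- A measurable function with an explicit bound, as an element of the space. -/
def ofBound (f : Z → ℝ) (hf : Measurable f) (C : ℝ) (hC : ∀ z, |f z| ≤ C) :
    BoundedMeasurable Z :=
  ⟨⟨f, memℓp_infty ⟨C, by rintro _ ⟨z, rfl⟩; exact hC z⟩⟩, hf⟩

@[simp] theorem eval_ofBound (f : Z → ℝ) (hf : Measurable f) (C : ℝ) (hC : ∀ z, |f z| ≤ C)
    (z : Z) : (ofBound f hf C hC).eval z = f z := rfl

@[simp] theorem eval_add (g h : BoundedMeasurable Z) (z : Z) :
    (g + h).eval z = g.eval z + h.eval z := rfl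

@[simp] theorem eval_smul (c : ℝ) (h : BoundedMeasurable Z) (z : Z) :
    (c • h).eval z = c * h.eval z := rfl

theorem ext_eval {g h : BoundedMeasurable Z} (H : ∀ z, g.eval z = h.eval z) : g = h :=
  Subtype.ext (lp.ext (funext H))

theorem norm_le_of_eval {h : BoundedMeasurable Z} {C : ℝ} (hC : 0 ≤ C)
    (H : ∀ z, |h.eval z| ≤ C) : ‖h‖ ≤ C :=
  lp.norm_le_of_forall_le (E := fun _ : Z => ℝ) hC H

theorem integrable_eval (h : BoundedMeasurable Z) (μ : Measure Z) [IsProbabilityMeasure μ] :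
    Integrable h.eval μ :=
  Integrable.of_bound h.measurable_eval.aestronglyMeasurable ‖h‖
    (Eventually.of_forall fun z => h.abs_eval_le z)

theorem abs_integral_le (h : BoundedMeasurable Z) (μ : Measure Z) [IsProbabilityMeasure μ] :
    |∫ z, h.eval z ∂μ| ≤ ‖h‖ := by
  have := norm_integral_le_of_norm_le_const (μ := μ) (f := h.eval) (C := ‖h‖)
    (Eventually.of_forall fun z => h.abs_eval_le z)
  simpa using this

theorem abs_discount_le (Q : Kernel Z Z) [IsMarkovKernel Q] (β h : BoundedMeasurable Z) (z : Z) :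
    |β.eval z * ∫ z', h.eval z' ∂(Q z)| ≤ ‖β‖ * ‖h‖ := by
  rw [abs_mul]
  exact mul_le_mul (β.abs_eval_le z) (h.abs_integral_le (Q z)) (abs_nonneg _) (norm_nonneg _)

end BoundedMeasurable

/-- The discount operator `(L_β h)(z) = β(z) ∫ h(z') Q(z, dz')` on bounded measurable functions,
as a bounded linear operator. -/
def discountOp {Z : Type*} [MeasurableSpace Z] (Q : Kernel Z Z) [IsMarkovKernel Q]
    (β : BoundedMeasurable Z) : BoundedMeasurable Z →L[ℝ] BoundedMeasurable Z :=
  LinearMap.mkContinuous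
    { toFun := fun h =>
        BoundedMeasurable.ofBound (fun z => β.eval z * ∫ z', h.eval z' ∂(Q z))
          (β.measurable_eval.mul
            h.measurable_eval.stronglyMeasurable.integral_kernel.measurable)
          (‖β‖ * ‖h‖) (BoundedMeasurable.abs_discount_le Q β h)
      map_add' := fun g h => BoundedMeasurable.ext_eval fun z => by
        simp only [BoundedMeasurable.eval_ofBound, BoundedMeasurable.eval_add]
        rw [integral_add (g.integrable_eval _) (h.integrable_eval _), mul_add]
      map_smul' := fun c h => BoundedMeasurable.ext_eval fun z => by
        simp only [BoundedMeasurable.eval_ofBound, BoundedMeasurable.eval_smul, RingHom.id_apply]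
        rw [integral_const_mul]
        ring }
    ‖β‖
    (fun h => BoundedMeasurable.norm_le_of_eval (by positivity)
      (BoundedMeasurable.abs_discount_le Q β h))

/-- `r` is the spectral radius of `L` in Gelfand's form: `r = lim ‖Lⁿ‖^(1/n)`. (For a bounded
operator this limit always exists.) -/
def IsSpectralRadius {E : Type*} [SeminormedAddCommGroup E] [NormedSpace ℝ E] (L : E →L[ℝ] E)
    (r : ℝ) : Prop :=
  Tendsto (fun n : ℕ => ‖L ^ n‖ ^ (1 / (n : ℝ))) atTop (𝓝 r)

/-- The upper integral of a possibly non-measurable function with values in `[0, ∞]`; it is the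
usual integral if the function is measurable. -/
def upperLIntegral {Z : Type*} [MeasurableSpace Z] (μ : Measure Z) (f : Z → ℝ≥0∞) : ℝ≥0∞ :=
  ⨅ (u : Z → ℝ≥0∞) (_ : Measurable u) (_ : ∀ z, f z ≤ u z), ∫⁻ z, u z ∂μ

/-! ### Dynamic programs -/

/-- A dynamic program with endogenous states `X`, exogenous states `Z` and actions `A`. The state
space is `X × Z`. Only the values `H s a v` with `a ∈ Γ s` and `v ∈ cand` are meaningful. -/
structure DynamicProgram (X Z A : Type*) [TopologicalSpace X] [TopologicalSpace Z] where
  /-- the feasible correspondence -/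
  Γ : X × Z → Set A
  /-- the candidate value functions -/
  cand : Set (X × Z → ℝ)
  cand_nonempty : cand.Nonempty
  cand_measurable : ∀ v ∈ cand, Measurable[borel (X × Z)] v
  /-- the continuation aggregator -/
  H : X × Z → A → (X × Z → ℝ) → ℝ

namespace DynamicProgram

section Basic

variable {X Z A : Type*} [TopologicalSpace X] [TopologicalSpace Z] (D : DynamicProgram X Z A)

/-- The feasible state-action pairs. -/
def graph : Set ((X × Z) × A) := {p | p.2 ∈ D.Γ p.1}

/-- The feasible policies: Borel measurable selections of the feasible correspondence. -/
def IsFeasible [MeasurableSpace A] (σ : X × Z → A) : Prop :=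
  Measurable[borel (X × Z)] σ ∧ ∀ s, σ s ∈ D.Γ s

/-- The policy operator `T_σ`. -/
def policyOp (σ : X × Z → A) (v : X × Z → ℝ) : X × Z → ℝ := fun s => D.H s (σ s) v

/-- The Bellman operator `T`. -/
def bellmanOp (v : X × Z → ℝ) : X × Z → ℝ := fun s => ⨆ a : D.Γ s, D.H s a v

/-- `w` is the pointwise limit of `T_σⁿ v₀`, for every candidate value function `v₀`. -/
def HasPolicyValue (σ : X × Z → A) (w : X × Z → ℝ) : Prop :=
  ∀ v₀ ∈ D.cand, ∀ s, Tendsto (fun n : ℕ => ((D.policyOp σ)^[n] v₀) s) atTop (𝓝 (w s))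

open Classical in
/-- The `σ`-value function `v_σ = lim T_σⁿ v₀`, provided that the limit exists and does not depend
on `v₀` (and `0` otherwise). -/
def policyValue (σ : X × Z → A) : X × Z → ℝ :=
  if h : ∃ w, D.HasPolicyValue σ w then h.choose else 0

/-- The value function `v* = sup_σ v_σ`, over all feasible policies `σ`. -/
def valueFunction [MeasurableSpace A] : X × Z → ℝ := fun s =>
  ⨆ σ : {σ : X × Z → A // D.IsFeasible σ}, D.policyValue σ.1 s

/-- Monotonicity of the aggregator in the continuation value. -/
def Monotonicity : Prop :=
  ∀ v ∈ D.cand, ∀ w ∈ D.cand, (∀ s, v s ≤ w s) →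
    ∀ s, ∀ a ∈ D.Γ s, D.H s a v ≤ D.H s a w

/-- Regular dynamic programs. -/
structure IsRegular [TopologicalSpace A] : Prop where
  cand_eq : D.cand = boundedBorel (X × Z)
  upperHemicontinuous : UpperHemicontinuous D.Γ
  lowerHemicontinuous : LowerHemicontinuous D.Γ
  nonempty : ∀ s, (D.Γ s).Nonempty
  compact : ∀ s, IsCompact (D.Γ s)
  measurable_H : ∀ v ∈ boundedBorel (X × Z),
    Measurable[borel D.graph] (fun p : D.graph => D.H p.1.1 p.1.2 v)
  continuous_H : ∀ v ∈ boundedCont (X × Z),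
    Continuous (fun p : D.graph => D.H p.1.1 p.1.2 v)
  bounded_H : ∃ v ∈ boundedCont (X × Z), ∃ C : ℝ,
    ∀ p : D.graph, |D.H p.1.1 p.1.2 v| ≤ C

end Basic

/-- Long-run contractivity with respect to the transition kernel `Q` of the exogenous state.
The integral over `z'` is an upper integral because the supremum over `x'` need not be
measurable. -/
def LongRunContractive {X Z A : Type*} [TopologicalSpace X] [TopologicalSpace Z]
    [MeasurableSpace Z] (D : DynamicProgram X Z A) (Q : Kernel Z Z) [IsMarkovKernel Q] : Prop :=
  ∃ β : BoundedMeasurable Z, (∀ z, 0 ≤ β.eval z) ∧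
    (∀ v ∈ D.cand, ∀ w ∈ D.cand, ∀ (x : X) (z : Z), ∀ a ∈ D.Γ (x, z),
      ‖D.H (x, z) a v - D.H (x, z) a w‖ₑ ≤ ENNReal.ofReal (β.eval z) *
        upperLIntegral (Q z) (fun z' => ⨆ x' : X, ‖v (x', z') - w (x', z')‖ₑ)) ∧
    ∃ r : ℝ, IsSpectralRadius (discountOp Q β) r ∧ r < 1

end DynamicProgram

end

/-! ### The discount operator -/

/-! Write `L` for `discountOp Q β`. A single policy operator need not be a contraction, but its
`n`-th iterate is Lipschitz with constant `‖L ^ n‖` (`abs_iterate_sub_le`), and spectral radius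
below one makes these constants summable. This gives the policy values, with bounds uniform in the
policy (`exists_policyValue`), and their fixed point property.

For convergence, compare each policy value `v_{σ_k}` with the value `v_ρ` of an arbitrary fixed
feasible `ρ`. If `v_ρ - v_τ ≤ h(z)` with `h ≥ 0` and `τ'` is greedy for `v_τ`, then `v_ρ = T_ρ v_ρ ≤
T_ρ (v_ρ ⊔ v_τ) ≤ T_ρ v_τ + L h ≤ T v_τ + L h ≤ v_τ' + L h` (`policyValue_sub_le_discountOp`). So
the gap at step `k` is at most `L ^ k` applied to a constant, uniformly in `ρ`. The supremum over
`ρ` comes last, so neither a Bellman equation for `v*` nor an optimal policy is needed. -/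

theorem IsSpectralRadius.summable_norm_pow {E : Type*} [SeminormedAddCommGroup E]
    [NormedSpace ℝ E] {L : E →L[ℝ] E} {r : ℝ} (h : IsSpectralRadius L r) (hr : r < 1) :
    Summable fun n : ℕ => ‖L ^ n‖ := by
  -- Eventually `‖L ^ n‖ < q ^ n`. The case `n = 0` is excluded because there `1 / n = 0` and the
  -- root cannot be undone.
  obtain ⟨q, hq, hq1⟩ := exists_between (max_lt hr zero_lt_one)
  have hq0 : 0 < q := (le_max_right _ _).trans_lt hq
  refine Summable.of_norm_bounded_eventually_nat
    (summable_geometric_of_lt_one hq0.le hq1) ?_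
  filter_upwards [h.eventually (gt_mem_nhds ((le_max_left _ _).trans_lt hq)),
    eventually_gt_atTop 0] with n hn hn0
  have h1 := Real.rpow_le_rpow (by positivity) hn.le (Nat.cast_nonneg n)
  rw [← Real.rpow_mul (norm_nonneg _), one_div, inv_mul_cancel₀ (by positivity),
    Real.rpow_one, Real.rpow_natCast] at h1
  rwa [norm_norm]

namespace BoundedMeasurable

variable {Z : Type*} [MeasurableSpace Z]

/-- The constant function with value `c`. -/
def const (Z : Type*) [MeasurableSpace Z] (c : ℝ) : BoundedMeasurable Z :=
  ofBound (fun _ => c) measurable_const |c| fun _ => le_rfl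

theorem norm_const_le {c : ℝ} (hc : 0 ≤ c) : ‖const Z c‖ ≤ c :=
  norm_le_of_eval hc fun _ => (abs_of_nonneg hc).le

end BoundedMeasurable

section Discount

variable {Z : Type*} [MeasurableSpace Z] (Q : Kernel Z Z) [IsMarkovKernel Q]
  {β : BoundedMeasurable Z}

theorem discountOp_eval (h : BoundedMeasurable Z) (z : Z) :
    (discountOp Q β h).eval z = β.eval z * ∫ z', h.eval z' ∂(Q z) := rfl

theorem discountOp_nonneg (hβ : ∀ z, 0 ≤ β.eval z) {h : BoundedMeasurable Z}
    (hh : ∀ z, 0 ≤ h.eval z) (z : Z) : 0 ≤ (discountOp Q β h).eval z :=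
  mul_nonneg (hβ z) (integral_nonneg hh)

theorem discountOp_pow_nonneg (hβ : ∀ z, 0 ≤ β.eval z) {h : BoundedMeasurable Z}
    (hh : ∀ z, 0 ≤ h.eval z) (n : ℕ) (z : Z) : 0 ≤ ((discountOp Q β ^ n) h).eval z := by
  induction n generalizing z with
  | zero => exact hh z
  | succ n ih =>
    rw [pow_succ', mul_apply_eq_comp]
    exact discountOp_nonneg Q hβ ih z

theorem discountOp_pow_const_le (n : ℕ) {c : ℝ} (hc : 0 ≤ c) (z : Z) :
    ((discountOp Q β ^ n) (BoundedMeasurable.const Z c)).eval z ≤ ‖discountOp Q β ^ n‖ * c :=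
  (le_abs_self _).trans <| (BoundedMeasurable.abs_eval_le _ z).trans <|
    (ContinuousLinearMap.le_opNorm _ _).trans <|
      mul_le_mul_of_nonneg_left (BoundedMeasurable.norm_const_le hc) (norm_nonneg _)

/-- A measurable majorant competes in the infimum defining the upper integral. Working with
majorants removes upper integrals from the rest of the argument. -/
theorem ofReal_mul_upperLIntegral_le (hβ : ∀ z, 0 ≤ β.eval z) {h : BoundedMeasurable Z}
    (hh : ∀ z, 0 ≤ h.eval z) {f : Z → ℝ≥0∞} (hf : ∀ z, f z ≤ ENNReal.ofReal (h.eval z))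
    (z : Z) : ENNReal.ofReal (β.eval z) * upperLIntegral (Q z) f ≤
      ENNReal.ofReal ((discountOp Q β h).eval z) := by
  rw [discountOp_eval, ENNReal.ofReal_mul (hβ z), ofReal_integral_eq_lintegral_ofReal
    (h.integrable_eval _) (Eventually.of_forall hh)]
  gcongr
  exact iInf₂_le_of_le _ h.measurable_eval.ennreal_ofReal (iInf_le _ hf)

end Discount

/-! ### Borel measurability of graphs of maps -/

/-- Measurability for the product σ-algebra would not suffice, as `S` need not be second countable.
But an open `U` is a union of boxes `V_B ×ˢ B` over a countable basis of `A`, where `V_B` is the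
union of all open `V` with `V ×ˢ B ⊆ U`. That union may be uncountable, yet it is open. -/
theorem measurable_prodMk_borel {S A : Type*} [TopologicalSpace S] [TopologicalSpace A]
    [SecondCountableTopology A] [MeasurableSpace A] [BorelSpace A] {σ : S → A}
    (hσ : Measurable[borel S] σ) :
    @Measurable _ _ (borel S) (borel (S × A)) fun s => (s, σ s) := by
  let _ : MeasurableSpace S := borel S
  have : BorelSpace S := ⟨rfl⟩
  let _ : MeasurableSpace (S × A) := borel (S × A)
  refine measurable_generateFrom fun U (hU : IsOpen U) => ?_
  have hB := TopologicalSpace.isBasis_countableBasis A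
  have hcover : (fun s => (s, σ s)) ⁻¹' U = ⋃ B ∈ TopologicalSpace.countableBasis A,
      (⋃₀ {V : Set S | IsOpen V ∧ V ×ˢ B ⊆ U}) ∩ σ ⁻¹' B := by
    ext s
    simp only [Set.mem_preimage, Set.mem_iUnion, Set.mem_inter_iff, Set.mem_sUnion,
      Set.mem_ofPred_eq, exists_prop]
    constructor
    · intro hs
      obtain ⟨V, W, hV, hW, hsV, hsW, hVW⟩ := isOpen_prod_iff.1 hU _ _ hs
      obtain ⟨B, hB', hsB, hBW⟩ := hB.exists_subset_of_mem_open hsW hW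
      exact ⟨B, hB', ⟨V, ⟨hV, (Set.prod_mono_right hBW).trans hVW⟩, hsV⟩, hsB⟩
    · rintro ⟨B, -, ⟨V, ⟨-, hV⟩, hsV⟩, hsB⟩
      exact hV ⟨hsV, hsB⟩
  rw [hcover]
  refine MeasurableSet.biUnion (TopologicalSpace.countable_countableBasis A) fun B hB' => ?_
  exact (isOpen_sUnion fun V hV => hV.1).measurableSet.inter (hσ (hB.isOpen hB').measurableSet)

theorem measurable_borel_subtype_mk {S Y : Type*} [MeasurableSpace S] [TopologicalSpace Y]
    {p : Y → Prop} {f : S → Y} (hf : @Measurable _ _ _ (borel Y) f) (hp : ∀ s, p (f s)) :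
    @Measurable _ _ _ (borel {y // p y}) fun s => (⟨f s, hp s⟩ : {y // p y}) := by
  let _ : MeasurableSpace Y := borel Y
  have : BorelSpace Y := ⟨rfl⟩
  rw [← (inferInstance : BorelSpace {y // p y}).measurable_eq]
  exact hf.subtype_mk

/-! ### Contractivity of the aggregator and of the policy operators -/

namespace DynamicProgram

variable {X Z A : Type*} [TopologicalSpace X] [TopologicalSpace Z] {D : DynamicProgram X Z A}

theorem HasPolicyValue.policyValue_eq {τ : X × Z → A} {w : X × Z → ℝ}
    (h : D.HasPolicyValue τ w) : D.policyValue τ = w := by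
  have hex : ∃ w, D.HasPolicyValue τ w := ⟨w, h⟩
  obtain ⟨v₀, hv₀⟩ := D.cand_nonempty
  rw [policyValue, dif_pos hex]
  exact funext fun s => tendsto_nhds_unique (hex.choose_spec v₀ hv₀ s) (h v₀ hv₀ s)

theorem IsRegular.exists_abs_sub_le [TopologicalSpace A] (hreg : D.IsRegular) {v w : X × Z → ℝ}
    (hv : v ∈ D.cand) (hw : w ∈ D.cand) : ∃ c, 0 ≤ c ∧ ∀ s, |v s - w s| ≤ c := by
  rw [hreg.cand_eq] at hv hw
  obtain ⟨-, C, hC⟩ := hv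
  obtain ⟨-, C', hC'⟩ := hw
  refine ⟨max (C + C') 0, le_max_right _ _, fun s => le_max_of_le_left ?_⟩
  exact (abs_sub _ _).trans (add_le_add (hC s) (hC' s))

variable [MeasurableSpace Z] {Q : Kernel Z Z} [IsMarkovKernel Q] {β : BoundedMeasurable Z}

/-- Long-run contractivity with a given discount factor process, expressed through measurable
bounds on the distance of the two continuation values. -/
structure IsDiscounted (D : DynamicProgram X Z A) (Q : Kernel Z Z) [IsMarkovKernel Q]
    (β : BoundedMeasurable Z) : Prop where
  nonneg : ∀ z, 0 ≤ β.eval z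
  abs_sub_le : ∀ v ∈ D.cand, ∀ w ∈ D.cand, ∀ h : BoundedMeasurable Z, (∀ z, 0 ≤ h.eval z) →
    (∀ s, |v s - w s| ≤ h.eval s.2) →
      ∀ s, ∀ a ∈ D.Γ s, |D.H s a v - D.H s a w| ≤ (discountOp Q β h).eval s.2
  summable : Summable fun n : ℕ => ‖discountOp Q β ^ n‖

theorem LongRunContractive.exists_isDiscounted (h : D.LongRunContractive Q) :
    ∃ β, D.IsDiscounted Q β := by
  obtain ⟨β, hβ, hH, r, hr, hr1⟩ := h
  refine ⟨β, hβ, ?_, hr.summable_norm_pow hr1⟩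
  rintro v hv w hw h hh hvw ⟨x, z⟩ a ha
  have h1 := (hH v hv w hw x z a ha).trans <| ofReal_mul_upperLIntegral_le Q hβ hh
    (fun z' => iSup_le fun x' => by
      rw [← ofReal_norm, Real.norm_eq_abs]
      exact ENNReal.ofReal_le_ofReal (hvw (x', z'))) z
  rw [← ofReal_norm, Real.norm_eq_abs] at h1
  exact (ENNReal.ofReal_le_ofReal_iff (discountOp_nonneg Q hβ hh z)).1 h1

namespace IsDiscounted

theorem abs_sub_le_const (hD : D.IsDiscounted Q β) {v w : X × Z → ℝ} (hv : v ∈ D.cand)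
    (hw : w ∈ D.cand) {c : ℝ} (hc : 0 ≤ c) (hvw : ∀ s, |v s - w s| ≤ c) (s : X × Z) {a : A}
    (ha : a ∈ D.Γ s) : |D.H s a v - D.H s a w| ≤ ‖discountOp Q β‖ * c := by
  refine (hD.abs_sub_le v hv w hw (.const Z c) (fun _ => hc) hvw s a ha).trans ?_
  simpa using discountOp_pow_const_le Q (β := β) 1 hc s.2

theorem abs_iterate_sub_le (hD : D.IsDiscounted Q β) {τ : X × Z → A} (hτ : ∀ s, τ s ∈ D.Γ s)
    (hmap : Set.MapsTo (D.policyOp τ) D.cand D.cand) {v w : X × Z → ℝ}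
    (hv : v ∈ D.cand) (hw : w ∈ D.cand) {c : ℝ} (hc : 0 ≤ c) (hvw : ∀ s, |v s - w s| ≤ c)
    (n : ℕ) (s : X × Z) :
    |(D.policyOp τ)^[n] v s - (D.policyOp τ)^[n] w s| ≤ ‖discountOp Q β ^ n‖ * c := by
  -- The induction carries a function of `z`; carrying norms would only give `‖L‖ ^ n`, which need
  -- not decay.
  suffices H : ∀ s, |(D.policyOp τ)^[n] v s - (D.policyOp τ)^[n] w s| ≤
      ((discountOp Q β ^ n) (.const Z c)).eval s.2 from
    (H s).trans (discountOp_pow_const_le Q n hc s.2)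
  induction n with
  | zero => exact hvw
  | succ n ih =>
    intro s
    rw [pow_succ', mul_apply_eq_comp, Function.iterate_succ_apply',
      Function.iterate_succ_apply']
    exact hD.abs_sub_le _ (hmap.iterate n hv) _ (hmap.iterate n hw) _
      (discountOp_pow_nonneg Q hD.nonneg (h := .const Z c) (fun _ => hc) n) ih s _ (hτ s)

end IsDiscounted

section Regular

variable [TopologicalSpace A]

/-- Boundedness at one candidate spreads to all, since candidates lie at finite sup-distance. -/
theorem IsDiscounted.exists_abs_H_le (hD : D.IsDiscounted Q β) (hreg : D.IsRegular)
    {v : X × Z → ℝ} (hv : v ∈ D.cand) : ∃ C, ∀ s, ∀ a ∈ D.Γ s, |D.H s a v| ≤ C := by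
  obtain ⟨u, ⟨huc, hub⟩, C, hC⟩ := hreg.bounded_H
  have hu : u ∈ D.cand := by
    rw [hreg.cand_eq]
    let _ : MeasurableSpace (X × Z) := borel _
    have : BorelSpace (X × Z) := ⟨rfl⟩
    exact ⟨huc.measurable, hub⟩
  obtain ⟨c, hc, hvu⟩ := hreg.exists_abs_sub_le hv hu
  refine ⟨‖discountOp Q β‖ * c + C, fun s a ha => ?_⟩
  have h1 := hD.abs_sub_le_const hv hu hc hvu s ha
  have h2 := hC ⟨(s, a), ha⟩
  calc |D.H s a v| = |(D.H s a v - D.H s a u) + D.H s a u| := by ring_nf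
    _ ≤ _ := (abs_add_le _ _).trans (add_le_add h1 h2)

theorem IsDiscounted.policyOp_le_bellmanOp (hD : D.IsDiscounted Q β) (hreg : D.IsRegular)
    {τ : X × Z → A} (hτ : ∀ s, τ s ∈ D.Γ s) {v : X × Z → ℝ} (hv : v ∈ D.cand) (s : X × Z) :
    D.policyOp τ v s ≤ D.bellmanOp v s := by
  obtain ⟨C, hC⟩ := hD.exists_abs_H_le hreg hv
  refine le_ciSup (f := fun a : D.Γ s => D.H s a v) ⟨C, ?_⟩ ⟨τ s, hτ s⟩
  rintro _ ⟨a, rfl⟩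
  exact (le_abs_self _).trans (hC s a a.2)

variable [SecondCountableTopology A] [MeasurableSpace A] [BorelSpace A]

theorem IsDiscounted.mapsTo_policyOp (hD : D.IsDiscounted Q β) (hreg : D.IsRegular)
    {τ : X × Z → A} (hτ : D.IsFeasible τ) : Set.MapsTo (D.policyOp τ) D.cand D.cand := by
  intro v hv
  obtain ⟨C, hC⟩ := hD.exists_abs_H_le hreg hv
  rw [hreg.cand_eq] at hv ⊢
  let _ : MeasurableSpace (X × Z) := borel _
  exact ⟨(hreg.measurable_H v hv).comp
    (measurable_borel_subtype_mk (measurable_prodMk_borel hτ.1) hτ.2),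
    C, fun s => hC s _ (hτ.2 s)⟩

/-- Every feasible policy has a value, at a distance from a given candidate that is bounded
uniformly in the policy. -/
theorem IsDiscounted.exists_policyValue (hD : D.IsDiscounted Q β) (hreg : D.IsRegular)
    {v : X × Z → ℝ} (hv : v ∈ D.cand) : ∃ C, 0 ≤ C ∧ ∀ τ, D.IsFeasible τ →
      ∃ w ∈ D.cand, D.HasPolicyValue τ w ∧ ∀ s, |w s - v s| ≤ C := by
  obtain ⟨B, hB⟩ := hD.exists_abs_H_le hreg hv
  obtain ⟨B', hB'⟩ : ∃ B', ∀ s, |v s| ≤ B' := by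
    rw [hreg.cand_eq] at hv
    exact hv.2
  -- `B' + B` bounds the first step `|v - T_τ v|` for every `τ` at once, which makes the final
  -- constant independent of `τ`. The `max` covers an empty state space.
  have hc0 : 0 ≤ max (B' + B) 0 := le_max_right _ _
  set c := max (B' + B) 0
  have hsum : Summable fun n : ℕ => ‖discountOp Q β ^ n‖ * c := hD.summable.mul_right c
  refine ⟨∑' n, ‖discountOp Q β ^ n‖ * c, tsum_nonneg fun n => by positivity,
    fun τ hτ => ?_⟩
  have hmap := hD.mapsTo_policyOp hreg hτ
  have hdist : ∀ s n, dist ((D.policyOp τ)^[n] v s) ((D.policyOp τ)^[n + 1] v s) ≤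
      ‖discountOp Q β ^ n‖ * c := fun s n => by
    rw [Real.dist_eq, Function.iterate_succ_apply]
    refine hD.abs_iterate_sub_le hτ.2 hmap hv (hmap hv) hc0 (fun s => ?_) n s
    exact (abs_sub _ _).trans (le_max_of_le_left (add_le_add (hB' s) (hB s _ (hτ.2 s))))
  choose w hw using fun s => cauchySeq_tendsto_of_complete
    (cauchySeq_of_dist_le_of_summable _ (hdist s) hsum)
  have hwv : ∀ s, |w s - v s| ≤ ∑' n, ‖discountOp Q β ^ n‖ * c := fun s => by
    rw [abs_sub_comm]
    exact dist_le_tsum_of_dist_le_of_tendsto₀ _ (hdist s) hsum (hw s)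
  refine ⟨w, ?_, fun v₀ hv₀ s => ?_, hwv⟩
  · have hiter := fun n => hmap.iterate n hv
    rw [hreg.cand_eq] at hiter ⊢
    let _ : MeasurableSpace (X × Z) := borel _
    refine ⟨measurable_of_tendsto_metrizable (fun n => (hiter n).1) (tendsto_pi_nhds.2 hw),
      (∑' n, ‖discountOp Q β ^ n‖ * c) + B', fun s => ?_⟩
    calc |w s| = |(w s - v s) + v s| := by ring_nf
      _ ≤ _ := (abs_add_le _ _).trans (add_le_add (hwv s) (hB' s))
  · obtain ⟨c', hc', hvv⟩ := hreg.exists_abs_sub_le hv₀ hv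
    have hlim : Tendsto (fun n => (D.policyOp τ)^[n] v₀ s - (D.policyOp τ)^[n] v s) atTop
        (𝓝 0) := by
      refine squeeze_zero_norm (fun n => hD.abs_iterate_sub_le hτ.2 hmap hv₀ hv hc' hvv n s) ?_
      simpa using hD.summable.tendsto_atTop_zero.mul_const c'
    simpa using hlim.add (hw s)

theorem IsDiscounted.policyValue_spec (hD : D.IsDiscounted Q β) (hreg : D.IsRegular)
    {τ : X × Z → A} (hτ : D.IsFeasible τ) :
    D.HasPolicyValue τ (D.policyValue τ) ∧ D.policyValue τ ∈ D.cand := by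
  obtain ⟨v, hv⟩ := D.cand_nonempty
  obtain ⟨C, -, hC⟩ := hD.exists_policyValue hreg hv
  obtain ⟨w, hw, hτw, -⟩ := hC τ hτ
  rw [hτw.policyValue_eq]
  exact ⟨hτw, hw⟩

theorem IsDiscounted.exists_abs_policyValue_sub_le (hD : D.IsDiscounted Q β)
    (hreg : D.IsRegular) {v : X × Z → ℝ} (hv : v ∈ D.cand) :
    ∃ C, 0 ≤ C ∧ ∀ τ, D.IsFeasible τ → ∀ s, |D.policyValue τ s - v s| ≤ C := by
  obtain ⟨C, hC0, hC⟩ := hD.exists_policyValue hreg hv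
  refine ⟨C, hC0, fun τ hτ => ?_⟩
  obtain ⟨w, -, hτw, hwv⟩ := hC τ hτ
  rwa [hτw.policyValue_eq]

/-- Pointwise convergence does not pass through `T_τ`. The tails of the summable series make the
convergence of the iterates uniform, and `T_τ` is Lipschitz in the sup-distance. -/
theorem IsDiscounted.policyOp_policyValue (hD : D.IsDiscounted Q β) (hreg : D.IsRegular)
    {τ : X × Z → A} (hτ : D.IsFeasible τ) :
    D.policyOp τ (D.policyValue τ) = D.policyValue τ := by
  obtain ⟨hval, hmem⟩ := hD.policyValue_spec hreg hτ
  have hmap := hD.mapsTo_policyOp hreg hτ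
  obtain ⟨c, hc, hle⟩ := hreg.exists_abs_sub_le (hmap hmem) hmem
  set w := D.policyValue τ
  have hsum : Summable fun n : ℕ => ‖discountOp Q β ^ n‖ * c := hD.summable.mul_right c
  have hdist : ∀ n s, |(D.policyOp τ)^[n] w s - w s| ≤ ∑' m, ‖discountOp Q β ^ (n + m)‖ * c :=
    fun n s => by
      refine dist_le_tsum_of_dist_le_of_tendsto _ (fun n => ?_) hsum (hval w hmem s) n
      rw [dist_comm, Real.dist_eq, Function.iterate_succ_apply]
      exact hD.abs_iterate_sub_le hτ.2 hmap (hmap hmem) hmem hc hle n s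
  have htail : Tendsto (fun n => ∑' m, ‖discountOp Q β ^ (n + m)‖ * c) atTop (𝓝 0) := by
    simpa only [add_comm] using tendsto_sum_nat_add fun n => ‖discountOp Q β ^ n‖ * c
  funext s
  have hlim : Tendsto (fun n => (D.policyOp τ)^[n + 1] w s - D.policyOp τ w s) atTop (𝓝 0) := by
    refine squeeze_zero_norm (fun n => ?_) (by simpa using htail.const_mul ‖discountOp Q β‖)
    rw [Function.iterate_succ_apply']
    exact hD.abs_sub_le_const (hmap.iterate n hmem) hmem
      (tsum_nonneg fun m => by positivity) (hdist n) s (hτ.2 s)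
  exact tendsto_nhds_unique (tendsto_sub_nhds_zero_iff.1 hlim)
    ((tendsto_add_atTop_iff_nat 1).2 (hval w hmem s))

/-! ### Policy improvement -/

/-- Since `v_τ = T_τ v_τ ≤ T v_τ = T_τ' v_τ`, monotonicity keeps all later iterates of `T_τ'` from
`v_τ` above `T v_τ`, and they converge to `v_τ'`. -/
theorem IsDiscounted.bellmanOp_le_policyValue (hD : D.IsDiscounted Q β) (hreg : D.IsRegular)
    (hmon : D.Monotonicity) {τ τ' : X × Z → A} (hτ : D.IsFeasible τ) (hτ' : D.IsFeasible τ')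
    (hgreedy : D.policyOp τ' (D.policyValue τ) = D.bellmanOp (D.policyValue τ)) (s : X × Z) :
    D.bellmanOp (D.policyValue τ) s ≤ D.policyValue τ' s := by
  have hmem := (hD.policyValue_spec hreg hτ).2
  have hmap := hD.mapsTo_policyOp hreg hτ'
  have himp : ∀ s, D.policyValue τ s ≤ D.policyOp τ' (D.policyValue τ) s := fun s => by
    rw [hgreedy]
    conv_lhs => rw [← hD.policyOp_policyValue hreg hτ]
    exact hD.policyOp_le_bellmanOp hreg hτ.2 hmem s
  have hiter : ∀ n s, D.policyOp τ' (D.policyValue τ) s ≤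
      (D.policyOp τ')^[n + 1] (D.policyValue τ) s := fun n => by
    induction n with
    | zero => exact fun s => le_rfl
    | succ n ih =>
      intro s
      rw [Function.iterate_succ_apply']
      exact hmon _ hmem _ (hmap.iterate (n + 1) hmem) (fun s => (himp s).trans (ih s)) s _
        (hτ'.2 s)
  rw [← hgreedy]
  exact ge_of_tendsto' ((tendsto_add_atTop_iff_nat 1).2
    ((hD.policyValue_spec hreg hτ').1 _ hmem s)) fun n => hiter n s

/-- Policy improvement from `τ` to `τ'` discounts the shortfall of the value relative to any other
feasible policy `ρ`. -/
theorem IsDiscounted.policyValue_sub_le_discountOp (hD : D.IsDiscounted Q β)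
    (hreg : D.IsRegular) (hmon : D.Monotonicity) {τ τ' ρ : X × Z → A} (hτ : D.IsFeasible τ)
    (hτ' : D.IsFeasible τ') (hρ : D.IsFeasible ρ)
    (hgreedy : D.policyOp τ' (D.policyValue τ) = D.bellmanOp (D.policyValue τ))
    {h : BoundedMeasurable Z} (hh : ∀ z, 0 ≤ h.eval z)
    (hle : ∀ s, D.policyValue ρ s - D.policyValue τ s ≤ h.eval s.2) (s : X × Z) :
    D.policyValue ρ s - D.policyValue τ' s ≤ (discountOp Q β h).eval s.2 := by
  have hτm := (hD.policyValue_spec hreg hτ).2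
  have hρm := (hD.policyValue_spec hreg hρ).2
  -- Contractivity needs a two-sided bound, but `hle` is one-sided. Replacing `v_ρ` by the maximum
  -- puts the difference from `v_τ` between `0` and `h`.
  have hmax : (fun s => max (D.policyValue ρ s) (D.policyValue τ s)) ∈ D.cand := by
    rw [hreg.cand_eq] at hτm hρm ⊢
    let _ : MeasurableSpace (X × Z) := borel _
    obtain ⟨C, hC⟩ := hτm.2
    obtain ⟨C', hC'⟩ := hρm.2
    exact ⟨hρm.1.max hτm.1, max C' C, fun s =>
      abs_max_le_max_abs_abs.trans (max_le_max (hC' s) (hC s))⟩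
  have h1 : D.policyValue ρ s ≤
      D.H s (ρ s) fun s => max (D.policyValue ρ s) (D.policyValue τ s) := by
    conv_lhs => rw [← hD.policyOp_policyValue hreg hρ]
    exact hmon _ hρm _ hmax (fun s => le_max_left _ _) s _ (hρ.2 s)
  have h2 := hD.abs_sub_le _ hmax _ hτm h hh (fun s => by
    rw [abs_of_nonneg (sub_nonneg.2 (le_max_right _ _)), ← max_sub_sub_right, sub_self]
    exact max_le (hle s) (hh _)) s _ (hρ.2 s)
  have h3 : D.H s (ρ s) (D.policyValue τ) ≤ D.policyValue τ' s :=
    (hD.policyOp_le_bellmanOp hreg hρ.2 hτm s).trans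
      (hD.bellmanOp_le_policyValue hreg hmon hτ hτ' hgreedy s)
  linarith [le_of_abs_le h2]

end Regular

end DynamicProgram

/-- Convergence of Howard's policy iteration: the policy values and the value function are well
defined, and the values of the policies generated by the algorithm converge uniformly to the
value function. -/
theorem theoremt {X Z A : Type*} [MetricSpace X] [MetricSpace Z] [MetricSpace A]
    [TopologicalSpace.SeparableSpace A]
    [MeasurableSpace Z] [BorelSpace Z] [MeasurableSpace A] [BorelSpace A]
    (Q : Kernel Z Z) [IsMarkovKernel Q] (D : DynamicProgram X Z A)
    (hreg : D.IsRegular) (hmon : D.Monotonicity) (hcon : D.LongRunContractive Q)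
    (σ : ℕ → X × Z → A) (hσ : ∀ k, D.IsFeasible (σ k))
    (hhoward : ∀ k, D.policyOp (σ (k + 1)) (D.policyValue (σ k)) =
      D.bellmanOp (D.policyValue (σ k))) :
    (∀ τ, D.IsFeasible τ → D.HasPolicyValue τ (D.policyValue τ) ∧
      D.policyValue τ ∈ boundedBorel (X × Z)) ∧
    (∀ s, IsLUB {y | ∃ τ, D.IsFeasible τ ∧ y = D.policyValue τ s} (D.valueFunction s)) ∧
    TendstoUniformly (fun k => D.policyValue (σ k)) D.valueFunction atTop := by
  have : SecondCountableTopology A := UniformSpace.secondCountable_of_separable A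
  obtain ⟨β, hD⟩ := hcon.exists_isDiscounted
  -- `C` bounds the distance of all policy values from `v_{σ_0}`: it makes the supremum finite and
  -- starts the induction on `k`.
  obtain ⟨C, hC0, hC⟩ :=
    hD.exists_abs_policyValue_sub_le hreg (hD.policyValue_spec hreg (hσ 0)).2
  have hbdd : ∀ s, BddAbove (Set.range
      fun τ : {τ : X × Z → A // D.IsFeasible τ} => D.policyValue τ.1 s) := fun s => by
    refine ⟨D.policyValue (σ 0) s + C, ?_⟩
    rintro _ ⟨τ, rfl⟩
    linarith [le_of_abs_le (hC τ.1 τ.2 s)]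
  have : Nonempty {τ : X × Z → A // D.IsFeasible τ} := ⟨⟨σ 0, hσ 0⟩⟩
  refine ⟨fun τ hτ => ?_, fun s => ?_, ?_⟩
  · rw [← hreg.cand_eq]
    exact hD.policyValue_spec hreg hτ
  · have hset : {y | ∃ τ, D.IsFeasible τ ∧ y = D.policyValue τ s} = Set.range
        fun τ : {τ : X × Z → A // D.IsFeasible τ} => D.policyValue τ.1 s := by
      ext y
      simp [eq_comm]
    rw [hset]
    exact isLUB_ciSup (hbdd s)
  · have hgap : ∀ k, ∀ τ, D.IsFeasible τ → ∀ s, D.policyValue τ s - D.policyValue (σ k) s ≤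
        ((discountOp Q β ^ k) (.const Z C)).eval s.2 := fun k τ hτ => by
      induction k with
      | zero => exact fun s => le_of_abs_le (hC τ hτ s)
      | succ k ih =>
        rw [pow_succ', mul_apply_eq_comp]
        exact hD.policyValue_sub_le_discountOp hreg hmon (hσ k) (hσ (k + 1)) hτ (hhoward k)
          (discountOp_pow_nonneg Q hD.nonneg (h := .const Z C) (fun _ => hC0) k) ih
    rw [Metric.tendstoUniformly_iff]
    intro ε hε
    have hlim : Tendsto (fun k : ℕ => ‖discountOp Q β ^ k‖ * C) atTop (𝓝 0) := by
      simpa using hD.summable.tendsto_atTop_zero.mul_const C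
    filter_upwards [hlim.eventually (gt_mem_nhds hε)] with k hk s
    refine lt_of_le_of_lt ?_ hk
    have hle : D.policyValue (σ k) s ≤ D.valueFunction s := le_ciSup (hbdd s) ⟨σ k, hσ k⟩
    rw [Real.dist_eq, abs_of_nonneg (sub_nonneg.2 hle), sub_le_iff_le_add]
    -- The bound is independent of `τ` and of the state, so it passes to the supremum and is
    -- uniform.
    exact ciSup_le fun τ => sub_le_iff_le_add.1
      ((hgap k τ.1 τ.2 s).trans (discountOp_pow_const_le Q k hC0 s.2))
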